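/- Let $f$ be an $L_p$-nested function on $\mathbb R^n$, $n\ge 1$: a finite rooted ordered tree is given, each inner node $I$ has an exponent $p_I>0$ and $\ell_I\ge 1$ children $(I,1),\dots,(I,\ell_I)$, the leaves correspond bijectively to the coordinates $x_1,\dots,x_n$, and $x_n$ is the rightmost leaf. The function $f_I$ of a leaf $I$ with coordinate $x_i$ is $|x_i|$ (and $p_I:=1$), that of an inner node is $f_I(x_I)=\big(\sum_{j=1}^{\ell_I} f_{I,j}(x_{I,j})^{p_I}\big)^{1/p_I}$, and $f=f_\emptyset$ is the function of the root $\emptyset$. Here $x_I$ denotes the coordinates that are leaves under $I$, and $x_{\widehat I}$ the others. Fix a sign $\Delta_n\in\{1,-1\}$. The polar-like coordinates $r=f(x)$, $u_i=x_i/f(x)$ $(1\le i<n)$ map $\{x\in\mathbb R^n:\operatorname{sgn}x_n=\Delta_n\}$ bijectively onto $\Omega=\{(r,u): r>0,\ f(u_1,\dots,u_{n-1},0)<1\}$. The inverse is $x_i=ru_i$ $(i<n)$, $x_n=r\Delta_n u_n$, where $u_n>0$ is the solution of $f(u_1,\dots,u_{n-1},u_n)=1$. Let $\mathcal L$ be the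 set of nodes on the path from the root to the leaf $x_n$, excluding the root. Every node $L \in \mathcal L$ is the last child $(I,\ell_I)$ of its parent $I$. Define recursively $g_\emptyset=1$ and $$g_{I,\ell_I}(u_{\widehat{I,\ell_I}})=\Big(g_I(u_{\widehat I})^{p_I}-\sum_{j=1}^{\ell_I-1}f_{I,j}(u_{I,j})^{p_I}\Big)^{1/p_I}.$$ Then, on $\Omega$, $g_L$ is positive, depends only on $u_{\widehat L}$, and equals the value $f_L(u_L)$ of the node $L$ for the normalized vector $(u_1,\dots,u_{n-1},\Delta_nu_n)$; in particular $u_n$ is the value $g$ of the leaf $x_n$ (with $u_1=g_\emptyset=1$ if $n=1$ and the tree is a single leaf). Put $$G_{I,\ell_I}(u_{\widehat{I,\ell_I}})=g_{I,\ell_I}(u_{\widehat{I,\ell_I}})^{p_{I,\ell_I}-p_I}=\Big(g_I(u_{\widehat I})^{p_I}-\sum_{j=1}^{\ell_I-1}f_{I,j}(u_{I,j})^{p_I}\Big)^{\frac{p_{I,\ell_I}-p_I}{p_I}}.$$ Let $\mathcal J=(\partial x_i/\partial y_j)_{ij}$, with $y_1=r$ and $y_{j}=u_{j-1}$ for $2\le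 j\le n$, be the Jacobian of the inverse map. The inverse map is differentiable at every point of $\Omega$ with $u_i\ne0$ for all $i<n$, and at every point of $\Omega$ where all partial derivatives $\partial x_i/\partial y_j$ exist, $$|\det\mathcal J|=r^{n-1}\prod_{L\in\mathcal L}G_L(u_{\widehat L}).$$ -/

import Mathlib

/-- Trees of `L_p`-nested functions, with leaves labelled by coordinates in `ι`.  An inner node
carries an exponent `p > 0` and an ordered, non-empty family of `k + 1` children. -/
inductive LpTree (ι : Type*) where
  | leaf (i : ι) : LpTree ι
  | node (p : ℝ) (hp : 0 < p) (k : ℕ) (c : Fin (k + 1) → LpTree ι) : LpTree ι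

noncomputable section

namespace LpTree

/-- The labels of the leaves of a tree, with multiplicity. -/
def leaves {ι : Type*} : LpTree ι → Multiset ι
  | leaf i => {i}
  | node _ _ _ c => ∑ j, (c j).leaves

/-- The `L_p`-nested function of a tree: a leaf has the value `|x i|`, and an inner node is the
`L_p`-norm of the values of its children. -/
def f {ι : Type*} : LpTree ι → (ι → ℝ) → ℝ
  | leaf i, x => |x i|
  | node p _ _ c, x => (∑ j, (c j).f x ^ p) ^ (1 / p)

/-- The exponent at the top node of a tree; leaves get the exponent `1`. -/
def p {ι : Type*} : LpTree ι → ℝ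
  | leaf _ => 1
  | node p _ _ _ => p

/-- The label of the rightmost leaf. -/
def lastLeaf {ι : Type*} : LpTree ι → ι
  | leaf i => i
  | node _ _ k c => (c (Fin.last k)).lastLeaf

/-- The depth of the rightmost leaf: the number of nodes on the path from the root to that leaf,
not counting the root. -/
def depth {ι : Type*} : LpTree ι → ℕ
  | leaf _ => 0
  | node _ _ k c => (c (Fin.last k)).depth + 1

/-- The subtree under the last child (a leaf is left as it is). -/
def lastChild {ι : Type*} : LpTree ι → LpTree ι
  | leaf i => leaf i
  | node _ _ k c => c (Fin.last k)

/-- The subtree under the node of depth `k` on the path from the root to the rightmost leaf. -/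
def spine {ι : Type*} (T : LpTree ι) : ℕ → LpTree ι
  | 0 => T
  | k + 1 => (T.spine k).lastChild

/-- The sum `∑ f_j(x) ^ p` over all children `j` of the top node except the last one. -/
def siblingSum {ι : Type*} : LpTree ι → (ι → ℝ) → ℝ
  | leaf _, _ => 0
  | node p _ k c, x => ∑ j : Fin k, (c j.castSucc).f x ^ p

/-- The value `g` of the node of depth `k` on the path to the rightmost leaf, computed from
`u = (u_1, …, u_{n-1})` (with `n = m + 1`) by descending from the root, whose value is fixed to
one, and solving at each node for the value of its last child.  The placeholder `0` in the last
coordinate is never used when the last coordinate belongs to the rightmost leaf only. -/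
def g {m : ℕ} (T : LpTree (Fin (m + 1))) (u : Fin m → ℝ) : ℕ → ℝ
  | 0 => 1
  | k + 1 => (T.g u k ^ (T.spine k).p - (T.spine k).siblingSum (Fin.snoc u 0 : Fin (m + 1) → ℝ))
      ^ (1 / (T.spine k).p)

/-- The term `G` of the node of depth `k + 1` on the path to the rightmost leaf: the value of that
node, to the power (exponent of the node) minus (exponent of its parent). -/
def G {m : ℕ} (T : LpTree (Fin (m + 1))) (u : Fin m → ℝ) (k : ℕ) : ℝ :=
  T.g u (k + 1) ^ ((T.spine (k + 1)).p - (T.spine k).p)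

/-- The coordinate `u_n ≥ 0` as a function of `u_1, …, u_{n-1}`: the value of the rightmost leaf. -/
def uLast {m : ℕ} (T : LpTree (Fin (m + 1))) (u : Fin m → ℝ) : ℝ :=
  T.g u T.depth

/-- Polar-like coordinates `y = (r, u_1, …, u_{n-1})` of `x`: `r = f x` and `u_i = x_i / f x`. -/
def polar {m : ℕ} (T : LpTree (Fin (m + 1))) (x : Fin (m + 1) → ℝ) : Fin (m + 1) → ℝ :=
  Fin.cons (T.f x) (fun i : Fin m => x i.castSucc / T.f x)

/-- The domain of the polar-like coordinates: `r > 0` and `f (u_1, …, u_{n-1}, 0) < 1`. -/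
def polarDomain {m : ℕ} (T : LpTree (Fin (m + 1))) : Set (Fin (m + 1) → ℝ) :=
  {y | 0 < y 0 ∧ T.f (Fin.snoc (Fin.tail y) 0 : Fin (m + 1) → ℝ) < 1}

/-- The inverse coordinate transformation with sign `Δ = sgn x_n`:
`x_i = r u_i` for `i < n` and `x_n = r Δ u_n`. -/
def invPolar {m : ℕ} (T : LpTree (Fin (m + 1))) (Δ : ℝ) (y : Fin (m + 1) → ℝ) :
    Fin (m + 1) → ℝ :=
  Fin.snoc (fun i : Fin m => y 0 * y i.succ) (y 0 * (Δ * T.uLast (Fin.tail y)))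

end LpTree

end

/-! At each node on the path to the last leaf, the power of the node value is the sibling sum plus
the same power of the last child's value, and the last coordinate enters no sibling sum. Hence `f =
1` determines every `g` from the root down (`g_eq_f_spine_of_f_eq_one`), and these values reassemble
to a vector with `f = 1` (`g_eq_f_spine_of_abs_eq`).

For the determinant, `x = r (u, Δ u_n(u))`. A column operation reduces it to `r^(n-1) |u_n - ∑ u_j
∂_j u_n|` (`abs_det_of_border`), and by Euler's argument the sum is the derivative of `u_n(t u)` at
`t = 1` (`uLast_sub_sum_partial`). Let `D_k` be the radial derivative of `g_k`, `q` the exponent at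
depth `k`, and `S` the sibling sum there. Differentiating `g_{k+1}(tu)^q = g_k(tu)^q - t^q S` gives
`(g_{k+1} - D_{k+1}) g_{k+1}^(q-1) = (g_k - D_k) g_k^(q-1)`. Replacing `q` on the left by the next
exponent costs exactly the factor `G`, so `(g - D) g^(p-1)` grows from `1` at the root to `∏ G` at
the leaf, where `p = 1` leaves `u_n - D` (`exists_hasDerivAt_g_smul`). -/

namespace LpTree

open Finset

/-! ### Nested functions and the path to the last leaf -/

section Basic

variable {ι : Type*}

theorem p_pos (T : LpTree ι) : 0 < T.p := by
  cases T with
  | leaf i => simp [p]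
  | node q hq k c => simpa [p] using hq

theorem f_nonneg (T : LpTree ι) (x : ι → ℝ) : 0 ≤ T.f x := by
  induction T with
  | leaf i => simp [f]
  | node q hq k c ih =>
    rw [f]
    exact Real.rpow_nonneg (sum_nonneg fun j _ => Real.rpow_nonneg (ih j) _) _

theorem f_smul (T : LpTree ι) {t : ℝ} (ht : 0 ≤ t) (x : ι → ℝ) : T.f (t • x) = t * T.f x := by
  induction T with
  | leaf i => simp [f, abs_mul, abs_of_nonneg ht]
  | node q hq k c ih =>
    have h : ∑ j, (c j).f (t • x) ^ q = t ^ q * ∑ j, (c j).f x ^ q := by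
      rw [mul_sum]
      exact sum_congr rfl fun j _ => by rw [ih, Real.mul_rpow ht (f_nonneg _ _)]
    rw [f, f, h, Real.mul_rpow (Real.rpow_nonneg ht _)
      (sum_nonneg fun j _ => Real.rpow_nonneg (f_nonneg _ _) _), one_div,
      Real.rpow_rpow_inv ht hq.ne']

theorem siblingSum_smul (T : LpTree ι) {t : ℝ} (ht : 0 ≤ t) (x : ι → ℝ) :
    T.siblingSum (t • x) = t ^ T.p * T.siblingSum x := by
  cases T with
  | leaf i => simp [siblingSum]
  | node q hq k c =>
    rw [siblingSum, siblingSum, p, mul_sum]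
    exact sum_congr rfl fun j _ => by rw [f_smul _ ht, Real.mul_rpow ht (f_nonneg _ _)]

theorem f_congr (T : LpTree ι) {x y : ι → ℝ} (h : ∀ i ∈ T.leaves, x i = y i) :
    T.f x = T.f y := by
  induction T with
  | leaf i => simp [f, h i (by simp [leaves])]
  | node q hq k c ih =>
    rw [f, f]
    congr 1
    refine sum_congr rfl fun j _ => ?_
    rw [ih j fun i hi => h i ?_]
    rw [leaves, Multiset.mem_sum]
    exact ⟨j, mem_univ j, hi⟩

theorem leaves_lastChild_subset (T : LpTree ι) : T.lastChild.leaves ⊆ T.leaves := by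
  cases T with
  | leaf i => exact fun _ h => h
  | node q hq k c =>
    intro i hi
    rw [leaves, Multiset.mem_sum]
    exact ⟨Fin.last k, mem_univ _, hi⟩

theorem nodup_leaves_lastChild {T : LpTree ι} (hT : T.leaves.Nodup) :
    T.lastChild.leaves.Nodup := by
  cases T with
  | leaf i => exact hT
  | node q hq k c =>
    rw [leaves, Fin.sum_univ_castSucc, Multiset.nodup_add] at hT
    exact hT.2.1

/-- Distinct leaf labels make the leaves of the other children disjoint from those of the last
child. -/
theorem siblingSum_congr {T : LpTree ι} (hT : T.leaves.Nodup) {x y : ι → ℝ}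
    (h : ∀ i, i ∉ T.lastChild.leaves → x i = y i) : T.siblingSum x = T.siblingSum y := by
  cases T with
  | leaf i => rfl
  | node q hq k c =>
    rw [leaves, Fin.sum_univ_castSucc, Multiset.nodup_add] at hT
    rw [siblingSum, siblingSum]
    refine sum_congr rfl fun j _ => ?_
    rw [f_congr _ fun i hi => h i fun hi' => ?_]
    exact Multiset.disjoint_left.1 hT.2.2 (Multiset.mem_sum.2 ⟨j, mem_univ j, hi⟩) hi'

theorem lastLeaf_mem_leaves (T : LpTree ι) : T.lastLeaf ∈ T.leaves := by
  induction T with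
  | leaf i => simp [lastLeaf, leaves]
  | node q hq k c ih =>
    rw [leaves, Multiset.mem_sum]
    exact ⟨Fin.last k, mem_univ _, ih _⟩

theorem lastLeaf_lastChild (T : LpTree ι) : T.lastChild.lastLeaf = T.lastLeaf := by
  cases T <;> rfl

theorem depth_lastChild (T : LpTree ι) : T.lastChild.depth = T.depth - 1 := by
  cases T <;> rfl

theorem f_rpow_p {T : LpTree ι} (hT : 0 < T.depth) (x : ι → ℝ) :
    T.f x ^ T.p = T.siblingSum x + T.lastChild.f x ^ T.p := by
  cases T with
  | leaf i => simp [depth] at hT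
  | node q hq k c =>
    rw [f, p, one_div, Real.rpow_inv_rpow
      (sum_nonneg fun j _ => Real.rpow_nonneg (f_nonneg _ _) _) hq.ne', Fin.sum_univ_castSucc]
    rfl

theorem eq_leaf_of_depth_eq_zero {T : LpTree ι} (hT : T.depth = 0) : T = leaf T.lastLeaf := by
  cases T with
  | leaf i => rfl
  | node q hq k c => simp [depth] at hT

theorem nodup_leaves_spine {T : LpTree ι} (hT : T.leaves.Nodup) (k : ℕ) :
    (T.spine k).leaves.Nodup := by
  induction k with
  | zero => exact hT
  | succ k ih => exact nodup_leaves_lastChild ih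

theorem lastLeaf_spine (T : LpTree ι) (k : ℕ) : (T.spine k).lastLeaf = T.lastLeaf := by
  induction k with
  | zero => rfl
  | succ k ih => exact (lastLeaf_lastChild _).trans ih

theorem depth_spine (T : LpTree ι) (k : ℕ) : (T.spine k).depth = T.depth - k := by
  induction k with
  | zero => rfl
  | succ k ih => rw [spine, depth_lastChild, ih, Nat.sub_sub]

theorem spine_depth (T : LpTree ι) : T.spine T.depth = leaf T.lastLeaf := by
  rw [eq_leaf_of_depth_eq_zero (T := T.spine T.depth) (by rw [depth_spine, Nat.sub_self]),
    lastLeaf_spine]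

theorem f_spine_rpow {T : LpTree ι} {k : ℕ} (hk : k < T.depth) (x : ι → ℝ) :
    (T.spine k).f x ^ (T.spine k).p =
      (T.spine k).siblingSum x + (T.spine (k + 1)).f x ^ (T.spine k).p :=
  f_rpow_p (by rw [depth_spine]; omega) x

theorem f_pos_of_lastLeaf_ne_zero (T : LpTree ι) {x : ι → ℝ} (hx : x T.lastLeaf ≠ 0) :
    0 < T.f x := by
  induction T with
  | leaf i => simpa [f, lastLeaf] using hx
  | node q hq k c ih =>
    rw [f]
    refine Real.rpow_pos_of_pos (sum_pos' (fun j _ => Real.rpow_nonneg (f_nonneg _ _) _)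
      ⟨Fin.last k, mem_univ _, Real.rpow_pos_of_pos (ih _ hx) _⟩) _

end Basic

/-! ### Differentiability away from vanishing coordinates -/

section Differentiability

variable {ι E : Type*} [NormedAddCommGroup E] [NormedSpace ℝ E]

/-- Absolute values and powers are only safe away from `0`. The dichotomy "differentiable and
nonzero, or identically zero" passes from coordinates to nodes, and its second case admits
coordinates held at `0`. -/
theorem differentiableAt_f_or_eq_zero (T : LpTree ι) {a : E → ι → ℝ} {e₀ : E}
    (ha : ∀ i, (DifferentiableAt ℝ (fun e => a e i) e₀ ∧ a e₀ i ≠ 0) ∨ ∀ e, a e i = 0) :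
    (DifferentiableAt ℝ (fun e => T.f (a e)) e₀ ∧ 0 < T.f (a e₀)) ∨ ∀ e, T.f (a e) = 0 := by
  induction T with
  | leaf i =>
    rcases ha i with ⟨h, h0⟩ | h
    · left
      exact ⟨by simpa only [f] using h.abs h0, by simpa [f] using h0⟩
    · right
      simp [f, h]
  | node q hq k c ih =>
    by_cases hz : ∀ j, ∀ e, (c j).f (a e) = 0
    · right
      intro e
      simp [f, hz, Real.zero_rpow hq.ne', Real.zero_rpow (inv_ne_zero hq.ne')]
    · left
      have hd : DifferentiableAt ℝ (fun e => ∑ j, (c j).f (a e) ^ q) e₀ := by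
        refine DifferentiableAt.fun_sum fun j _ => ?_
        rcases ih j with ⟨h, h0⟩ | h
        · exact h.rpow_const (Or.inl h0.ne')
        · simp only [h]
          exact differentiableAt_const _
      have hpos : 0 < ∑ j, (c j).f (a e₀) ^ q := by
        push Not at hz
        obtain ⟨j, e, hj⟩ := hz
        refine sum_pos' (fun j _ => Real.rpow_nonneg (f_nonneg _ _) _) ⟨j, mem_univ _, ?_⟩
        rcases ih j with ⟨_, h0⟩ | h
        · exact Real.rpow_pos_of_pos h0 _
        · exact absurd (h e) hj
      simp only [f]
      exact ⟨hd.rpow_const (Or.inl hpos.ne'), Real.rpow_pos_of_pos hpos _⟩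

theorem differentiableAt_siblingSum (T : LpTree ι) {a : E → ι → ℝ} {e₀ : E}
    (ha : ∀ i, (DifferentiableAt ℝ (fun e => a e i) e₀ ∧ a e₀ i ≠ 0) ∨ ∀ e, a e i = 0) :
    DifferentiableAt ℝ (fun e => T.siblingSum (a e)) e₀ := by
  cases T with
  | leaf i => simp [siblingSum]
  | node q hq k c =>
    simp only [siblingSum]
    refine DifferentiableAt.fun_sum fun j _ => ?_
    rcases differentiableAt_f_or_eq_zero (c j.castSucc) ha with ⟨h, h0⟩ | h
    · exact h.rpow_const (Or.inl h0.ne')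
    · simp only [h]
      exact differentiableAt_const _

end Differentiability

/-! ### Node values along the path -/

section NodeValues

variable {m : ℕ} {T : LpTree (Fin (m + 1))}

theorem siblingSum_spine_snoc (hT : T.leaves.Nodup) (hlast : T.lastLeaf = Fin.last m)
    (u : Fin m → ℝ) (a b : ℝ) (k : ℕ) :
    (T.spine k).siblingSum (Fin.snoc u a : Fin (m + 1) → ℝ) =
      (T.spine k).siblingSum (Fin.snoc u b : Fin (m + 1) → ℝ) := by
  refine siblingSum_congr (nodup_leaves_spine hT k) fun i => ?_
  refine Fin.lastCases (fun h => absurd ?_ h) (fun i _ => by simp) i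
  have := lastLeaf_mem_leaves (T.spine (k + 1))
  rwa [lastLeaf_spine, hlast] at this

theorem g_congr (hT : T.leaves.Nodup) (k : ℕ) {u v : Fin m → ℝ}
    (h : ∀ i : Fin m, i.castSucc ∉ (T.spine k).leaves → u i = v i) : T.g u k = T.g v k := by
  induction k with
  | zero => rfl
  | succ k ih =>
    rw [g, g, ih fun i hi => h i fun hi' => hi (leaves_lastChild_subset _ hi'),
      siblingSum_congr (nodup_leaves_spine hT k) (y := (Fin.snoc v 0 : Fin (m + 1) → ℝ))]
    intro i
    exact Fin.lastCases (fun _ => by simp) (fun i hi => by simpa using h i hi) i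

/-- Subtracting the same sibling sum from both sides preserves the strict inequality on the way
down. It keeps the base of every later real power positive. -/
theorem f_spine_snoc_lt_g {u : Fin m → ℝ} (hu : T.f (Fin.snoc u 0 : Fin (m + 1) → ℝ) < 1)
    {k : ℕ} (hk : k ≤ T.depth) :
    (T.spine k).f (Fin.snoc u 0 : Fin (m + 1) → ℝ) < T.g u k := by
  induction k with
  | zero => exact hu
  | succ k ih =>
    have hp := (T.spine k).p_pos
    have h := Real.rpow_lt_rpow (f_nonneg _ _) (ih (by omega)) hp
    rw [f_spine_rpow (by omega)] at h
    rw [g, one_div, Real.lt_rpow_inv_iff_of_pos (f_nonneg _ _) _ hp]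
    · linarith
    · linarith [Real.rpow_nonneg
        (f_nonneg (T.spine (k + 1)) (Fin.snoc u 0 : Fin (m + 1) → ℝ)) (T.spine k).p]

theorem g_pos {u : Fin m → ℝ} (hu : T.f (Fin.snoc u 0 : Fin (m + 1) → ℝ) < 1)
    {k : ℕ} (hk : k ≤ T.depth) : 0 < T.g u k :=
  (f_nonneg _ _).trans_lt (f_spine_snoc_lt_g hu hk)

theorem g_rpow_sub_pos {u : Fin m → ℝ} (hu : T.f (Fin.snoc u 0 : Fin (m + 1) → ℝ) < 1)
    {k : ℕ} (hk : k < T.depth) :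
    0 < T.g u k ^ (T.spine k).p - (T.spine k).siblingSum (Fin.snoc u 0 : Fin (m + 1) → ℝ) := by
  have h := Real.rpow_lt_rpow (f_nonneg _ _) (f_spine_snoc_lt_g hu hk.le) (T.spine k).p_pos
  rw [f_spine_rpow hk] at h
  linarith [Real.rpow_nonneg
    (f_nonneg (T.spine (k + 1)) (Fin.snoc u 0 : Fin (m + 1) → ℝ)) (T.spine k).p]

theorem g_succ_rpow {u : Fin m → ℝ} (hu : T.f (Fin.snoc u 0 : Fin (m + 1) → ℝ) < 1)
    {k : ℕ} (hk : k < T.depth) :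
    T.g u (k + 1) ^ (T.spine k).p =
      T.g u k ^ (T.spine k).p - (T.spine k).siblingSum (Fin.snoc u 0 : Fin (m + 1) → ℝ) := by
  rw [g, one_div, Real.rpow_inv_rpow (g_rpow_sub_pos hu hk).le (p_pos _).ne']

theorem G_eq {u : Fin m → ℝ} (hu : T.f (Fin.snoc u 0 : Fin (m + 1) → ℝ) < 1)
    {k : ℕ} (hk : k < T.depth) :
    T.G u k = (T.g u k ^ (T.spine k).p -
      (T.spine k).siblingSum (Fin.snoc u 0 : Fin (m + 1) → ℝ))
        ^ (((T.spine (k + 1)).p - (T.spine k).p) / (T.spine k).p) := by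
  rw [G, g, ← Real.rpow_mul (g_rpow_sub_pos hu hk).le]
  congr 1
  ring

/-- The induction climbs from the leaf, where equality is the choice of `a`. At `k = 0` it says that
the vector is normalized. -/
theorem g_eq_f_spine_of_abs_eq (hT : T.leaves.Nodup) (hlast : T.lastLeaf = Fin.last m)
    {u : Fin m → ℝ} (hu : T.f (Fin.snoc u 0 : Fin (m + 1) → ℝ) < 1) {a : ℝ}
    (ha : |a| = T.uLast u) {k : ℕ} (hk : k ≤ T.depth) :
    T.g u k = (T.spine k).f (Fin.snoc u a : Fin (m + 1) → ℝ) := by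
  induction hk using Nat.decreasingInduction with
  | self => simp [spine_depth, f, hlast, ha, uLast]
  | of_succ k hk ih =>
    have h := g_succ_rpow hu hk
    rw [ih, siblingSum_spine_snoc hT hlast u 0 a] at h
    refine (Real.rpow_left_inj (g_pos hu hk.le).le (f_nonneg _ _) (p_pos (T.spine k)).ne').1 ?_
    rw [f_spine_rpow hk]
    linarith

theorem g_eq_f_spine_of_f_eq_one (hT : T.leaves.Nodup) (hlast : T.lastLeaf = Fin.last m)
    {u : Fin m → ℝ} {a : ℝ} (h1 : T.f (Fin.snoc u a : Fin (m + 1) → ℝ) = 1)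
    {k : ℕ} (hk : k ≤ T.depth) :
    T.g u k = (T.spine k).f (Fin.snoc u a : Fin (m + 1) → ℝ) := by
  induction k with
  | zero => exact h1.symm
  | succ k ih =>
    rw [g, ih (by omega), f_spine_rpow (by omega), siblingSum_spine_snoc hT hlast u 0 a,
      add_sub_cancel_left, one_div, Real.rpow_rpow_inv (f_nonneg _ _) (p_pos _).ne']

/-- At the root this places the image of `polar` inside `polarDomain`. -/
theorem f_spine_snoc_zero_lt (hT : T.leaves.Nodup) (hlast : T.lastLeaf = Fin.last m)
    (u : Fin m → ℝ) {a : ℝ} (ha : a ≠ 0) {k : ℕ} (hk : k ≤ T.depth) :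
    (T.spine k).f (Fin.snoc u 0 : Fin (m + 1) → ℝ) <
      (T.spine k).f (Fin.snoc u a : Fin (m + 1) → ℝ) := by
  induction hk using Nat.decreasingInduction with
  | self => simpa [spine_depth, f, hlast] using ha
  | of_succ k hk ih =>
    have hp := (T.spine k).p_pos
    rw [← Real.rpow_lt_rpow_iff (f_nonneg _ _) (f_nonneg _ _) hp, f_spine_rpow hk,
      f_spine_rpow hk, siblingSum_spine_snoc hT hlast u 0 a]
    gcongr
    exact f_nonneg _ _

end NodeValues

/-! ### The coordinate map and its inverse -/

section Inverse

variable {m : ℕ} {T : LpTree (Fin (m + 1))} {Δ : ℝ}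

theorem uLast_pos {u : Fin m → ℝ} (hu : T.f (Fin.snoc u 0 : Fin (m + 1) → ℝ) < 1) :
    0 < T.uLast u :=
  g_pos hu le_rfl

theorem abs_sign_mul_uLast (hΔ : |Δ| = 1) {u : Fin m → ℝ}
    (hu : T.f (Fin.snoc u 0 : Fin (m + 1) → ℝ) < 1) : |Δ * T.uLast u| = T.uLast u := by
  rw [abs_mul, hΔ, one_mul, abs_of_pos (uLast_pos hu)]

theorem invPolar_eq_smul (y : Fin (m + 1) → ℝ) :
    T.invPolar Δ y =
      y 0 • (Fin.snoc (Fin.tail y) (Δ * T.uLast (Fin.tail y)) : Fin (m + 1) → ℝ) := by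
  funext i
  exact Fin.lastCases (by simp [invPolar]) (fun i => by simp [invPolar, Fin.tail]) i

theorem f_pos_of_sign (hlast : T.lastLeaf = Fin.last m) {x : Fin (m + 1) → ℝ}
    (hx : 0 < Δ * x (Fin.last m)) : 0 < T.f x :=
  f_pos_of_lastLeaf_ne_zero T (by rw [hlast]; exact right_ne_zero_of_mul hx.ne')

theorem snoc_tail_polar (x : Fin (m + 1) → ℝ) :
    (Fin.snoc (Fin.tail (T.polar x)) (x (Fin.last m) / T.f x) : Fin (m + 1) → ℝ) =
      (T.f x)⁻¹ • x := by
  funext i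
  refine Fin.lastCases ?_ (fun i => ?_) i
  · simp [div_eq_inv_mul]
  · simp [polar, div_eq_inv_mul]

theorem f_snoc_tail_polar {x : Fin (m + 1) → ℝ} (hx : 0 < T.f x) :
    T.f (Fin.snoc (Fin.tail (T.polar x)) (x (Fin.last m) / T.f x) : Fin (m + 1) → ℝ) = 1 := by
  rw [snoc_tail_polar, f_smul _ (inv_nonneg.2 hx.le), inv_mul_cancel₀ hx.ne']

theorem mapsTo_polar (hT : T.leaves.Nodup) (hlast : T.lastLeaf = Fin.last m) :
    Set.MapsTo T.polar {x | 0 < Δ * x (Fin.last m)} T.polarDomain := by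
  intro x hx
  have hf := f_pos_of_sign hlast hx
  refine ⟨by simpa [polar] using hf, ?_⟩
  rw [← f_snoc_tail_polar hf]
  exact f_spine_snoc_zero_lt hT hlast _
    (div_ne_zero (right_ne_zero_of_mul (ne_of_gt hx)) hf.ne') (Nat.zero_le _)

theorem mapsTo_invPolar (hΔ : |Δ| = 1) :
    Set.MapsTo (T.invPolar Δ) T.polarDomain {x | 0 < Δ * x (Fin.last m)} := by
  rintro y ⟨hr, hu⟩
  have h : Δ * Δ = 1 := by rw [← abs_mul_abs_self, hΔ, one_mul]
  have : Δ * (y 0 * (Δ * T.uLast (Fin.tail y))) = y 0 * T.uLast (Fin.tail y) := by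
    linear_combination (y 0 * T.uLast (Fin.tail y)) * h
  simpa [invPolar, this] using mul_pos hr (uLast_pos hu)

theorem leftInvOn_invPolar (hT : T.leaves.Nodup) (hlast : T.lastLeaf = Fin.last m)
    (hΔ : |Δ| = 1) :
    Set.LeftInvOn (T.invPolar Δ) T.polar {x | 0 < Δ * x (Fin.last m)} := by
  intro x hx
  have hf := f_pos_of_sign hlast hx
  have hu : T.uLast (Fin.tail (T.polar x)) = |x (Fin.last m)| / T.f x := by
    rw [uLast, g_eq_f_spine_of_f_eq_one hT hlast (f_snoc_tail_polar hf) le_rfl]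
    simp [spine_depth, f, hlast, abs_div, abs_of_pos hf]
  have habs : |x (Fin.last m)| = Δ * x (Fin.last m) := by
    rw [← abs_of_pos (id hx : 0 < Δ * x (Fin.last m)), abs_mul, hΔ, one_mul]
  have hs : Δ * T.uLast (Fin.tail (T.polar x)) = x (Fin.last m) / T.f x := by
    have h : Δ * Δ = 1 := by rw [← abs_mul_abs_self, hΔ, one_mul]
    rw [hu, habs]
    linear_combination (x (Fin.last m) / T.f x) * h
  rw [invPolar_eq_smul, hs, snoc_tail_polar]
  simp [polar, smul_smul, hf.ne']

theorem f_invPolar (hT : T.leaves.Nodup) (hlast : T.lastLeaf = Fin.last m)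
    (hΔ : |Δ| = 1) {y : Fin (m + 1) → ℝ} (hy : y ∈ T.polarDomain) :
    T.f (T.invPolar Δ y) = y 0 := by
  -- The left side is the root value `g` at depth `0`, which is `1` by definition.
  have h : 1 = T.f _ := g_eq_f_spine_of_abs_eq hT hlast hy.2 (abs_sign_mul_uLast hΔ hy.2)
    (Nat.zero_le _)
  rw [invPolar_eq_smul, f_smul _ hy.1.le, ← h, mul_one]

theorem rightInvOn_invPolar (hT : T.leaves.Nodup) (hlast : T.lastLeaf = Fin.last m)
    (hΔ : |Δ| = 1) : Set.RightInvOn (T.invPolar Δ) T.polar T.polarDomain := by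
  intro y hy
  have h0 : y 0 ≠ 0 := hy.1.ne'
  funext i
  simp only [polar, f_invPolar hT hlast hΔ hy]
  refine Fin.cases ?_ (fun i => ?_) i
  · simp
  · simp [invPolar, h0]

end Inverse

/-! ### Radial derivative and Euler's formula -/

section Derivative

variable {m : ℕ} {T : LpTree (Fin (m + 1))}

theorem differentiableAt_g {E : Type*} [NormedAddCommGroup E] [NormedSpace ℝ E]
    {b : E → Fin m → ℝ} {e₀ : E}
    (hb : ∀ i, (DifferentiableAt ℝ (fun e => b e i) e₀ ∧ b e₀ i ≠ 0) ∨ ∀ e, b e i = 0)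
    (hu : T.f (Fin.snoc (b e₀) 0 : Fin (m + 1) → ℝ) < 1) {k : ℕ} (hk : k ≤ T.depth) :
    DifferentiableAt ℝ (fun e => T.g (b e) k) e₀ := by
  induction k with
  | zero => simp only [g]; exact differentiableAt_const _
  | succ k ih =>
    simp only [g]
    refine DifferentiableAt.rpow_const (DifferentiableAt.sub
      ((ih (by omega)).rpow_const (Or.inl (g_pos hu (by omega)).ne'))
      (differentiableAt_siblingSum _ fun i => ?_)) (Or.inl (g_rpow_sub_pos hu hk).ne')
    exact Fin.lastCases (Or.inr (by simp)) (fun i => by simpa using hb i) i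

/-- The radial derivative of the node values along the path to the rightmost leaf. -/
theorem exists_hasDerivAt_g_smul {u : Fin m → ℝ}
    (hu : T.f (Fin.snoc u 0 : Fin (m + 1) → ℝ) < 1) {k : ℕ} (hk : k ≤ T.depth) :
    ∃ D, HasDerivAt (fun t : ℝ => T.g (t • u) k) D 1 ∧
      (T.g u k - D) * T.g u k ^ ((T.spine k).p - 1) = ∏ j ∈ range k, T.G u j := by
  induction k with
  | zero => exact ⟨0, by simpa only [g] using hasDerivAt_const _ _, by simp [g]⟩
  | succ k ih =>
    obtain ⟨D, hD, hE⟩ := ih (by omega)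
    set q := (T.spine k).p with hq
    set S := (T.spine k).siblingSum (Fin.snoc u 0 : Fin (m + 1) → ℝ)
    have hq0 : 0 < q := p_pos _
    have hg := g_pos hu (show k ≤ T.depth by omega)
    have hg' := g_pos hu hk
    have hX := g_rpow_sub_pos hu hk
    -- The sibling sum is homogeneous of degree `q`, so along the ray it is `t ^ q * S`:
    -- differentiable at `t = 1` even if some `u i` vanish.
    have hd : HasDerivAt (fun t : ℝ => (T.g (t • u) k ^ q - t ^ q * S) ^ (1 / q))
        ((D * q * T.g u k ^ (q - 1) - q * S) * (1 / q) *
          (T.g u k ^ q - S) ^ (1 / q - 1)) 1 := by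
      have h1 := hD.rpow_const (p := q) (Or.inl (by simpa using hg.ne'))
      have h2 := (Real.hasDerivAt_rpow_const (x := 1) (p := q) (Or.inl one_ne_zero)).mul_const S
      have h3 := (h1.fun_sub h2).rpow_const (p := 1 / q) (Or.inl (by simpa using hX.ne'))
      simpa using h3
    refine ⟨_, hd.congr_of_eventuallyEq ?_, ?_⟩
    · filter_upwards [lt_mem_nhds (zero_lt_one' ℝ)] with t ht
      have : (Fin.snoc (t • u) 0 : Fin (m + 1) → ℝ) =
          t • (Fin.snoc u 0 : Fin (m + 1) → ℝ) := by
        funext i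
        exact Fin.lastCases (by simp) (fun i => by simp) i
      rw [g, this, siblingSum_smul _ ht.le]
    · have hX' := g_succ_rpow hu hk
      have e1 : (T.g u k ^ q - S) ^ (1 / q - 1) = T.g u (k + 1) ^ (1 - q) := by
        rw [← hX', ← Real.rpow_mul hg'.le]
        congr 1
        rw [← hq]
        field_simp
      have e2 : T.g u (k + 1) ^ ((T.spine (k + 1)).p - 1) =
          T.G u k * T.g u (k + 1) ^ (q - 1) := by
        rw [G, ← Real.rpow_add hg']
        congr 1
        ring
      have e3 : T.g u (k + 1) ^ (1 - q) * T.g u (k + 1) ^ (q - 1) = 1 := by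
        rw [← Real.rpow_add hg']
        simp
      have e4 : T.g u (k + 1) * T.g u (k + 1) ^ (q - 1) = T.g u k ^ q - S := by
        rw [← hX', ← Real.rpow_one_add' hg'.le (by simpa using hq0.ne')]
        congr 1
        ring
      have e5 : T.g u k * T.g u k ^ (q - 1) = T.g u k ^ q := by
        rw [← Real.rpow_one_add' hg.le (by simpa using hq0.ne')]
        congr 1
        ring
      have e6 : (D * q * T.g u k ^ (q - 1) - q * S) * (1 / q) = D * T.g u k ^ (q - 1) - S := by
        field_simp
      rw [prod_range_succ, ← hE, e1, e2, e6]
      -- `e3` cancels the chain-rule factor, `e4` and `e5` merge the powers, and then `S` drops out.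
      linear_combination T.G u k * e4 - T.G u k * (D * T.g u k ^ (q - 1) - S) * e3 - T.G u k * e5

theorem exists_hasDerivAt_uLast_smul {u : Fin m → ℝ}
    (hu : T.f (Fin.snoc u 0 : Fin (m + 1) → ℝ) < 1) :
    ∃ D, HasDerivAt (fun t : ℝ => T.uLast (t • u)) D 1 ∧
      T.uLast u - D = ∏ j ∈ range T.depth, T.G u j := by
  obtain ⟨D, hD, h⟩ := exists_hasDerivAt_g_smul hu le_rfl
  refine ⟨D, hD, ?_⟩
  rw [← h, spine_depth]
  simp [p, uLast]

/-- Euler's formula for the radial derivative needs only the partial derivatives, even at points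
where some coordinates vanish. -/
theorem uLast_sub_sum_partial {u d : Fin m → ℝ}
    (hu : T.f (Fin.snoc u 0 : Fin (m + 1) → ℝ) < 1)
    (hd : ∀ j, HasDerivAt (fun t => T.uLast (Function.update u j t)) (d j) (u j)) :
    T.uLast u - ∑ j, u j * d j = ∏ k ∈ range T.depth, T.G u k := by
  obtain ⟨D, hD, hE⟩ := exists_hasDerivAt_uLast_smul hu
  -- `b` freezes the coordinates that vanish at `u`, which makes `T.uLast ∘ b` Fréchet
  -- differentiable there. Nothing is lost: terms with `u j = 0` drop out of Euler's sum, while `b`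
  -- fixes the ray `t • u` and the coordinate lines through `u` in the other directions.
  let b : (Fin m → ℝ) → Fin m → ℝ := fun v i => if u i = 0 then 0 else v i
  have hbu : b u = u := by
    funext i
    simp only [b]
    split_ifs with h
    exacts [h.symm, rfl]
  have hh : DifferentiableAt ℝ (fun v => T.uLast (b v)) u := by
    refine differentiableAt_g (fun i => ?_) (by rwa [hbu]) le_rfl
    by_cases h : u i = 0
    · exact Or.inr fun v => by simp [b, h]
    · refine Or.inl ⟨?_, by rwa [hbu]⟩
      simp only [b, h, if_false]
      exact differentiableAt_apply i u
  set h' := fderiv ℝ (fun v => T.uLast (b v)) u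
  have hpart : ∀ j, u j * d j = u j * h' (Pi.single j 1) := by
    intro j
    by_cases hj : u j = 0
    · simp [hj]
    have hcomp : HasDerivAt (fun t => T.uLast (b (Function.update u j t)))
        (h' (Pi.single j 1)) (u j) :=
      HasFDerivAt.comp_hasDerivAt_of_eq (u j) hh.hasFDerivAt (hasDerivAt_update u j (u j))
        (Function.update_eq_self j u).symm
    have heq : ∀ t, b (Function.update u j t) = Function.update u j t := by
      intro t
      funext i
      simp only [b]
      split_ifs with h
      · rw [Function.update_of_ne (by rintro rfl; exact hj h), h]
      · rfl
    simp only [heq] at hcomp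
    rw [(hd j).unique hcomp]
  have hrad : HasDerivAt (fun t : ℝ => T.uLast (b (t • u))) (h' u) 1 := by
    refine HasFDerivAt.comp_hasDerivAt_of_eq (1 : ℝ) hh.hasFDerivAt ?_ (one_smul ℝ u).symm
    simpa using (hasDerivAt_id (1 : ℝ)).smul_const u
  have hbsmul : ∀ t : ℝ, b (t • u) = t • u := by
    intro t
    funext i
    simp only [b]
    split_ifs with h
    exacts [by simp [h], rfl]
  simp only [hbsmul] at hrad
  have hsum : ∑ j, u j * h' (Pi.single j 1) = h' u := by
    conv_rhs => rw [pi_eq_sum_univ' u, map_sum]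
    exact sum_congr rfl fun j _ => by rw [map_smul, smul_eq_mul]
  rw [sum_congr rfl fun j _ => hpart j, hsum, ← hD.unique hrad, hE]

end Derivative

/-! ### The Jacobian determinant -/

section Jacobian

variable {m : ℕ} {T : LpTree (Fin (m + 1))} {Δ : ℝ}

theorem differentiableAt_invPolar {y : Fin (m + 1) → ℝ} (hy : y ∈ T.polarDomain)
    (h0 : ∀ i : Fin m, y i.succ ≠ 0) : DifferentiableAt ℝ (T.invPolar Δ) y := by
  have hg : DifferentiableAt ℝ (fun y => T.uLast (Fin.tail y)) y :=
    differentiableAt_g (fun i => Or.inl ⟨differentiableAt_apply i.succ y, h0 i⟩) hy.2 le_rfl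
  rw [differentiableAt_pi]
  refine Fin.lastCases ?_ fun i => ?_
  · simpa only [invPolar, Fin.snoc_last] using
      (differentiableAt_apply 0 y).fun_mul (hg.const_mul Δ)
  · simpa only [invPolar, Fin.snoc_castSucc] using
      (differentiableAt_apply 0 y).fun_mul (differentiableAt_apply i.succ y)

/-- The determinant of a matrix that is `r • 1` off its first column and last row, with first
column `a`, and the last row `b` off the first column. -/
theorem abs_det_of_border {J : Matrix (Fin (m + 1)) (Fin (m + 1)) ℝ} {r : ℝ} (hr : 0 < r)
    {u : Fin m → ℝ} (h0 : ∀ i : Fin m, J i.castSucc 0 = u i)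
    (h1 : ∀ i j : Fin m, J i.castSucc j.succ = if i = j then r else 0) :
    |J.det| = r ^ m * |J (Fin.last m) 0 - r⁻¹ * ∑ j, u j * J (Fin.last m) j.succ| := by
  -- `w` is chosen so that all rows of `J` but the last annihilate it.
  let w : Fin (m + 1) → ℝ := Fin.cons 1 fun j => -(r⁻¹ * u j)
  -- By Cramer's rule the new determinant is entry `0` of `adjugate J * J * w = det J • w`, and `w 0
  -- = 1`.
  have hw : (J.updateCol 0 (J.mulVec w)).det = J.det := by
    rw [← Matrix.cramer_apply, Matrix.cramer_eq_adjugate_mulVec, Matrix.mulVec_mulVec,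
      Matrix.adjugate_mul, Matrix.smul_mulVec, Matrix.one_mulVec]
    simp [w]
  have hcol : ∀ i : Fin m, J.mulVec w i.castSucc = 0 := by
    intro i
    simp [Matrix.mulVec, dotProduct, Fin.sum_univ_succ, w, h0, h1, hr.ne']
  have hlast : J.mulVec w (Fin.last m) =
      J (Fin.last m) 0 - r⁻¹ * ∑ j, u j * J (Fin.last m) j.succ := by
    simp only [Matrix.mulVec, dotProduct, Fin.sum_univ_succ, w, Fin.cons_zero, Fin.cons_succ,
      mul_sum, mul_one, sub_eq_add_neg, ← sum_neg_distrib]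
    congr 1
    exact sum_congr rfl fun j _ => by ring
  have hsub : (J.updateCol 0 (J.mulVec w)).submatrix Fin.castSucc Fin.succ =
      Matrix.diagonal fun _ : Fin m => r := by
    ext i j
    simp [h1, Matrix.diagonal_apply]
  rw [← hw, Matrix.det_succ_column_zero, Fin.sum_univ_castSucc]
  simp [hcol, hlast, hsub, abs_mul, abs_of_pos hr, mul_comm]

theorem abs_det_jacobian_invPolar (hΔ : |Δ| = 1) {y : Fin (m + 1) → ℝ} (hy : y ∈ T.polarDomain)
    {J : Matrix (Fin (m + 1)) (Fin (m + 1)) ℝ}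
    (hJ : ∀ i j, HasDerivAt (fun t : ℝ => T.invPolar Δ (Function.update y j t) i) (J i j) (y j)) :
    |J.det| = y 0 ^ m * ∏ k ∈ range T.depth, T.G (Fin.tail y) k := by
  have hr : 0 < y 0 := hy.1
  have hΔ0 : Δ ≠ 0 := by rintro rfl; simp at hΔ
  have hpos : 0 ≤ ∏ k ∈ range T.depth, T.G (Fin.tail y) k :=
    prod_nonneg fun k hk =>
      Real.rpow_nonneg (g_pos hy.2 (by have := mem_range.1 hk; omega)).le _
  have tail0 : ∀ t : ℝ, Fin.tail (Function.update y 0 t) = Fin.tail y := fun t => by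
    funext i; simp [Fin.tail]
  have tailS : ∀ (j : Fin m) (t : ℝ),
      Fin.tail (Function.update y j.succ t) = Function.update (Fin.tail y) j t := fun j t => by
    simp
  have h0 : ∀ i : Fin m, J i.castSucc 0 = Fin.tail y i := by
    intro i
    have h := hJ i.castSucc 0
    simp only [invPolar, Fin.snoc_castSucc, Function.update_self,
      Function.update_of_ne (Fin.succ_ne_zero i)] at h
    exact h.unique (by simpa [Fin.tail] using (hasDerivAt_id (y 0)).mul_const (y i.succ))
  have h1 : ∀ i j : Fin m, J i.castSucc j.succ = if i = j then y 0 else 0 := by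
    intro i j
    have h := hJ i.castSucc j.succ
    simp only [invPolar, Fin.snoc_castSucc,
      Function.update_of_ne (Fin.succ_ne_zero j).symm] at h
    refine h.unique ?_
    by_cases hij : i = j
    · subst hij
      simpa using (hasDerivAt_id (y i.succ)).const_mul (y 0)
    · have : i.succ ≠ j.succ := fun h => hij (Fin.succ_injective _ h)
      simpa [hij, Function.update_of_ne this] using hasDerivAt_const (y j.succ) (y 0 * y i.succ)
  have hl0 : J (Fin.last m) 0 = Δ * T.uLast (Fin.tail y) := by
    have h := hJ (Fin.last m) 0
    simp only [invPolar, Fin.snoc_last, Function.update_self, tail0] at h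
    exact h.unique (by simpa using (hasDerivAt_id (y 0)).mul_const (Δ * T.uLast (Fin.tail y)))
  -- Dividing the last row by the nonzero constant `r Δ` recovers the partial derivatives of `u_n`,
  -- so their existence need not be assumed separately.
  have hd : ∀ j : Fin m, HasDerivAt (fun t => T.uLast (Function.update (Fin.tail y) j t))
      ((y 0 * Δ)⁻¹ * J (Fin.last m) j.succ) (Fin.tail y j) := by
    intro j
    have h := (hJ (Fin.last m) j.succ).const_mul (y 0 * Δ)⁻¹
    simp only [invPolar, Fin.snoc_last, tailS,
      Function.update_of_ne (Fin.succ_ne_zero j).symm] at h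
    refine h.congr_of_eventuallyEq (Filter.Eventually.of_forall fun t => ?_)
    field_simp
  have hE := uLast_sub_sum_partial hy.2 hd
  have hJl : J (Fin.last m) 0 - (y 0)⁻¹ * ∑ j, Fin.tail y j * J (Fin.last m) j.succ =
      Δ * ∏ k ∈ range T.depth, T.G (Fin.tail y) k := by
    rw [hl0, ← hE, mul_sub, mul_sum, mul_sum]
    congr 1
    refine sum_congr rfl fun j _ => ?_
    field_simp
  rw [abs_det_of_border hr h0 h1, hJl, abs_mul, hΔ, one_mul, abs_of_nonneg hpos]

end Jacobian

end LpTree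

theorem proposition1 (m : ℕ) (T : LpTree (Fin (m + 1)))
    (hleaves : T.leaves = Finset.univ.val) (hlast : T.lastLeaf = Fin.last m)
    (Δ : ℝ) (hΔ : Δ = 1 ∨ Δ = -1) :
    -- `invPolar` is the inverse of the coordinate transformation on `{x | sgn x_n = Δ}`
    Set.BijOn T.polar {x | 0 < Δ * x (Fin.last m)} T.polarDomain ∧
    Set.InvOn (T.invPolar Δ) T.polar {x | 0 < Δ * x (Fin.last m)} T.polarDomain ∧
    -- the node value `g_L` depends only on the coordinates that are not leaves under `L`
    (∀ k ≤ T.depth, ∀ u u' : Fin m → ℝ,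
      (∀ i : Fin m, i.castSucc ∉ (T.spine k).leaves → u i = u' i) → T.g u k = T.g u' k) ∧
    ∀ y ∈ T.polarDomain,
      -- `g_L` is the value at the node `L` of the normalized vector, whose root value is one
      (∀ k ≤ T.depth, 0 < T.g (Fin.tail y) k ∧
        T.g (Fin.tail y) k = (T.spine k).f
          (Fin.snoc (Fin.tail y) (Δ * T.uLast (Fin.tail y)) : Fin (m + 1) → ℝ)) ∧
      -- the recursive form of the terms `G_L`
      (∀ k < T.depth, T.G (Fin.tail y) k =
        (T.g (Fin.tail y) k ^ (T.spine k).p -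
            (T.spine k).siblingSum (Fin.snoc (Fin.tail y) 0 : Fin (m + 1) → ℝ))
          ^ (((T.spine (k + 1)).p - (T.spine k).p) / (T.spine k).p)) ∧
      -- the inverse map is differentiable wherever no `u_i` vanishes
      ((∀ i : Fin m, y i.succ ≠ 0) → DifferentiableAt ℝ (T.invPolar Δ) y) ∧
      -- wherever the Jacobian matrix of partial derivatives exists, its determinant is as claimed
      (∀ J : Matrix (Fin (m + 1)) (Fin (m + 1)) ℝ,
        (∀ i j, HasDerivAt (fun t : ℝ => T.invPolar Δ (Function.update y j t) i) (J i j) (y j)) →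
        |J.det| = y 0 ^ m * ∏ k ∈ Finset.range T.depth, T.G (Fin.tail y) k) := by
  have hT : T.leaves.Nodup := hleaves ▸ Finset.univ.nodup
  have hΔ' : |Δ| = 1 := by rcases hΔ with rfl | rfl <;> simp
  have hinv : Set.InvOn (T.invPolar Δ) T.polar {x | 0 < Δ * x (Fin.last m)} T.polarDomain :=
    ⟨LpTree.leftInvOn_invPolar hT hlast hΔ', LpTree.rightInvOn_invPolar hT hlast hΔ'⟩
  refine ⟨hinv.bijOn (LpTree.mapsTo_polar hT hlast) (LpTree.mapsTo_invPolar hΔ'), hinv,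
    fun k _ _ _ h => LpTree.g_congr hT k h, fun y hy => ⟨fun k hk => ⟨LpTree.g_pos hy.2 hk,
      LpTree.g_eq_f_spine_of_abs_eq hT hlast hy.2 (LpTree.abs_sign_mul_uLast hΔ' hy.2) hk⟩,
      fun k hk => LpTree.G_eq hy.2 hk, LpTree.differentiableAt_invPolar hy,
      fun J hJ => LpTree.abs_det_jacobian_invPolar hΔ' hy hJ⟩⟩
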